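/- Let $D$ be a set of words and let $S=D\cup\{[_i,\,]_i : i\in\mathbb N\}$. Write $S^*$ (resp. $S^+$) for the finite (resp. nonempty finite) sequences over $S$, and $\mathfrak S(e)$ for the set of circular permutations of a sequence $e$. The set $\mathcal E$ of *expressions* consists of all circular permutations of sequences $[_i\,a$ with $i\in\mathbb N$ and $a$ a nonempty sequence over $D\cup\{]_j : j\ge 1\}$ that is not reduced to a single $]_j$. An expression is *local* if its unique opening bracket $[_i$ has $i\ge1$, and *global* if it is $[_0$; $\mathcal E_\ell$ and $\mathcal E_g$ are the sets of local and of global expressions. A *toric grammar* is a nonnegative finitely supported measure on $\mathcal E$ that is invariant under circular permutation; $\mathfrak G$ is the set of toric grammars. For $\mathcal G\in\mathfrak G$ and $a\in S^*$, $\mathcal G(aS^*)$ is the total weight of the expressions that start with $a$. A *text* is a toric grammar with integer weights supported by the circular permutations of sequences $[_0\,w_1\cdots w_k$, $k\ge1$, $w_j\in D$; $\mathfrak T$ is the set of texts. For a toric grammar $\mathcal G$ and an expression $e$, $\mathcal G\oplus e$ and $\mathcal G\ominus e$ denote $\mathcal G\pm\sum_{s\in\mathfrak S(e)}\delta_s$.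 *Merging, splitting.* $\alpha(\mathcal G)$ is the set of toric grammars of the form $\mathcal G\ominus a\,]_i\ominus[_i\,b\oplus ab$. Below, a *split* of $\mathcal G$ is a toric grammar $\mathcal G'=\mathcal G\ominus ab\oplus a\,]_i\oplus[_i\,b$ (in both cases with $a\,]_i,\ [_i\,b,\ ab\in\mathcal E$). For a reference grammar $\mathcal R\in\mathfrak G$ and parameters $\mu_1,\mu_2>0$: - $\beta_n(\mathcal G,\mathcal R)$ is the set of splits of $\mathcal G$ with $ab\in\mathcal E_g$ and $\mathcal R([_i\,b)>0$; - $\beta_b(\mathcal G,\mathcal R)$ is the set of splits with $\mathcal R(a\,]_i)+\mathcal R([_i\,b)>0$, $\mathcal R(aS^*)\le\mu_1\mathcal R([_0S^*)$, $\mathcal R(bS^*)\le\mu_2\mathcal R([_0S^*)$; - $\beta_i(\mathcal G,\mathcal R)$ is the set of splits with $\mathcal R([_iS^*)=0$, with $a$ or $b$ $\mathcal R$-maximal, and with the same two inequalities; here $a\in S^+$ is $\mathcal R$-maximal if $\mathcal R(awS^*)<\mathcal R(aS^*)$ and $\mathcal R(waS^*)<\mathcal R(aS^*)$ for all $w\in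 S$. *Label identification.* A map $f:\mathbb N\to\mathbb N$ with $f(0)=0$ acts on the labels of the brackets, and $f(\mathcal G)$ is the image measure; two grammars are isomorphic if one is the image of the other by a bijective such $f$. Let $\underline\chi_{\mathcal G}$ be a map fixing $0$ and indexing by the positive integers the classes of the smallest equivalence relation on $\mathbb N\setminus\{0\}$ that contains all $(i,j)$ for which $\mathcal G(a\,]_i)\mathcal G(a\,]_j)+\mathcal G([_i\,a)\mathcal G([_j\,a)>0$ for some $a\in S^*$; put $\underline\chi(\mathcal G)=\underline\chi_{\mathcal G}(\mathcal G)$, and let $\chi(\mathcal G)$ be $\underline\chi^k(\mathcal G)$, up to isomorphism, for the smallest $k$ such that $\underline\chi^k(\mathcal G)$ and $\underline\chi^{k+1}(\mathcal G)$ have the same number of labels $i$ with $]_i$ occurring. Let $\beta_\ell(\mathcal G)=\beta_i(\mathcal G,\mathcal G)$ if $\beta_b(\mathcal G,\mathcal G)=\varnothing$, and otherwise let $\beta_\ell(\mathcal G)$ be the set of all representatives of the $\chi(\mathcal G')$, $\mathcal G'\in\beta_b(\mathcal G,\mathcal G)$. *Processes.* A process with rule $\gamma$ is a time homogeneous Markov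 chain $(X_t)$ on $\mathfrak G$, stopped at $\tau=\inf\{t:\gamma(X_t)=\varnothing\}$, that moves from $\mathcal G$ to $\mathcal G'$ with positive probability if and only if $\mathcal G'\in\gamma(\mathcal G)$. The *production process*, the *learning process* and the *parsing process with reference $\mathcal R$* are (arbitrary) processes with rules $\alpha$, $\beta_\ell$ and $\beta_n(\cdot,\mathcal R)$. Let $$\mathbb T_{\mathcal G}(\mathcal T)=\mathbb P(X_\tau=\mathcal T\mid X_0=\mathcal G,\ X_\tau\in\mathfrak T)$$ for the production process (it is $0$ when the conditioning event is null), and, for a text $\mathcal T$, let $\mathbb G_{\mathcal T}(\mathcal G)$ and $\mathbb G_{\mathcal T,\mathcal R}(\mathcal G)$ be $\mathbb P(\tau<\infty,\ X_\tau=\mathcal G\mid X_0=\mathcal T)$ for the learning and for the parsing process respectively. Say that a process *reaches* $\mathcal G$ from $\mathcal T$ with positive probability if $\mathbb P(X_t=\mathcal G\text{ for some }t\le\tau\mid X_0=\mathcal T)>0$. **Statement.** For all $\mathcal G,\mathcal R\in\mathfrak G$ and $\mathcal T\in\mathfrak T$: 1. if $\mathbb G_{\mathcal T}(\mathcal G)>0$,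 or more generally if the learning process reaches $\mathcal G$ from $\mathcal T$ with positive probability, then $\mathbb T_{\mathcal G}(\mathcal T)>0$; 2. if $\mathbb G_{\mathcal T,\mathcal R}(\mathcal G)>0$, or more generally if the parsing process with reference $\mathcal R$ reaches $\mathcal G$ from $\mathcal T$ with positive probability, then $\mathbb T_{\mathcal G}(\mathcal T)>0$; 3. if $\mathbb T_{\mathcal G}(\mathcal T)>0$, then the parsing process with reference $\mathcal G$ reaches $\mathcal G$ from $\mathcal T$ with positive probability; if moreover $\beta_n(\mathcal G,\mathcal G)=\varnothing$ (the process stops at $\mathcal G$), then $\mathbb G_{\mathcal T,\mathcal G}(\mathcal G)>0$; 4. if $\operatorname{supp}(\mathcal G)\cap\mathcal E_\ell\subset\operatorname{supp}(\mathcal R)$, then $\mathbb T_{\mathcal G}(\mathcal T)>0$ if and only if the parsing process with reference $\mathcal R$ reaches $\mathcal G$ from $\mathcal T$ with positive probability; if moreover $\beta_n(\mathcal G,\mathcal R)=\varnothing$, then $\mathbb T_{\mathcal G}(\mathcal T)>0\iff\mathbb G_{\mathcal T,\mathcal R}(\mathcal G)>0$. -/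

import Mathlib

open scoped ENNReal

namespace Toric

/-- The symbols: words of the dictionary `D`, opening brackets `[_i` and closing brackets `]_i`. -/
inductive Symb (D : Type*) where
  | word (w : D) : Symb D
  | opn (i : ℕ) : Symb D
  | cls (i : ℕ) : Symb D

open Symb

variable {D : Type*}

/-- The action of a label map `f : ℕ → ℕ` on symbols. -/
def Symb.relabel (f : ℕ → ℕ) : Symb D → Symb D
  | word w => word w
  | opn i => opn (f i)
  | cls i => cls (f i)

/-- The expressions: the circular permutations of the sequences `[_i a`, where `a` is a nonempty
sequence of words and of closing brackets with positive labels, not reduced to a single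
closing bracket. -/
def IsExpr (e : List (Symb D)) : Prop :=
  ∃ (i : ℕ) (a : List (Symb D)), e ~r (opn i :: a) ∧ a ≠ [] ∧
    (∀ s ∈ a, (∃ w, s = word w) ∨ ∃ j, j ≠ 0 ∧ s = cls j) ∧ ¬ ∃ j, j ≠ 0 ∧ a = [cls j]

/-- Global expressions: those whose opening bracket is the start symbol `[_0`. -/
def IsGlobal (e : List (Symb D)) : Prop :=
  IsExpr e ∧ ∃ a, a ≠ [] ∧ e ~r (opn 0 :: a)

/-- Local expressions: those whose opening bracket has a positive label. -/
def IsLocal (e : List (Symb D)) : Prop :=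
  IsExpr e ∧ ∃ (i : ℕ) (a : List (Symb D)), i ≠ 0 ∧ a ≠ [] ∧ e ~r (opn i :: a)

/-- Toric grammars: positive measures with finite support on the set of expressions,
invariant under circular permutations. -/
@[ext]
structure Grammar (D : Type*) where
  weight : List (Symb D) →₀ ℝ
  nonneg : ∀ e, 0 ≤ weight e
  isExpr : ∀ e, weight e ≠ 0 → IsExpr e
  rotate : ∀ e e', e' ~r e → weight e' = weight e

open Classical in
/-- The measure `1 ⊗ e`: the sum of the unit masses at the distinct circular permutations of `e`. -/
noncomputable def orbit (e : List (Symb D)) : List (Symb D) →₀ ℝ :=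
  ∑ s ∈ e.cyclicPermutations.toFinset, Finsupp.single s 1

namespace Grammar

open Classical in
/-- `G(a S^*)`: the total weight of the sequences that start with `a`. -/
noncomputable def prefixWeight (G : Grammar D) (a : List (Symb D)) : ℝ :=
  G.weight.sum fun e r => if a <+: e then r else 0

/-- Texts: toric grammars with integer weights supported by the circular permutations of the
sequences `[_0 w_1 ... w_k`, with `k ≥ 1` words. -/
def IsText (T : Grammar D) : Prop :=
  (∀ e, ∃ n : ℕ, T.weight e = n) ∧
    ∀ e, T.weight e ≠ 0 → ∃ ws : List D, ws ≠ [] ∧ e ~r (opn 0 :: ws.map word)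

/-- `G' = f(G)`: the grammar `G'` is the image measure of `G` by the label map `f`. -/
def IsImage (f : ℕ → ℕ) (G G' : Grammar D) : Prop :=
  G'.weight = G.weight.mapDomain (List.map (Symb.relabel f))

/-- Isomorphic grammars: one is the image of the other by a one to one label map. -/
def Isomorphic (G G' : Grammar D) : Prop :=
  ∃ f : ℕ → ℕ, f 0 = 0 ∧ Function.Bijective f ∧ IsImage f G G'

/-- `G' = G ⊖ ab ⊕ a]_i ⊕ [_i b`. -/
def IsSplit (G G' : Grammar D) (i : ℕ) (a b : List (Symb D)) : Prop :=
  IsExpr (a ++ b) ∧ IsExpr (a ++ [cls i]) ∧ IsExpr (opn i :: b) ∧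
    G'.weight = G.weight - orbit (a ++ b) + orbit (a ++ [cls i]) + orbit (opn i :: b)

/-- The merge rule `α(G)`: the grammars `G ⊖ a]_i ⊖ [_i b ⊕ ab`. -/
def merge (G : Grammar D) : Set (Grammar D) :=
  {G' | ∃ (i : ℕ) (a b : List (Symb D)),
    IsExpr (a ++ [cls i]) ∧ IsExpr (opn i :: b) ∧ IsExpr (a ++ b) ∧
    G'.weight = G.weight - orbit (a ++ [cls i]) - orbit (opn i :: b) + orbit (a ++ b)}

/-- The narrow parsing rule `β_n(G, R)` with reference grammar `R`. -/
def narrowParse (G R : Grammar D) : Set (Grammar D) :=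
  {G' | ∃ (i : ℕ) (a b : List (Symb D)),
    IsSplit G G' i a b ∧ IsGlobal (a ++ b) ∧ 0 < R.weight (opn i :: b)}

/-- The broad parsing rule `β_b(G, R)`. -/
def broadParse (μ₁ μ₂ : ℝ) (G R : Grammar D) : Set (Grammar D) :=
  {G' | ∃ (i : ℕ) (a b : List (Symb D)),
    IsSplit G G' i a b ∧
    0 < R.weight (a ++ [cls i]) + R.weight (opn i :: b) ∧
    R.prefixWeight a ≤ μ₁ * R.prefixWeight [opn 0] ∧
    R.prefixWeight b ≤ μ₂ * R.prefixWeight [opn 0]}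

/-- `a` is `G`-maximal: `a` is nonempty and every one-symbol extension of `a`, to the right or to
the left, has a smaller weight in `G`. -/
def IsMaximal (G : Grammar D) (a : List (Symb D)) : Prop :=
  a ≠ [] ∧ ∀ s : Symb D, G.prefixWeight (a ++ [s]) < G.prefixWeight a ∧
    G.prefixWeight (s :: a) < G.prefixWeight a

/-- The innovation rule `β_i(G, R)`. -/
def innovate (μ₁ μ₂ : ℝ) (G R : Grammar D) : Set (Grammar D) :=
  {G' | ∃ (i : ℕ) (a b : List (Symb D)),
    IsSplit G G' i a b ∧
    R.prefixWeight [opn i] = 0 ∧ (R.IsMaximal a ∨ R.IsMaximal b) ∧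
    R.prefixWeight a ≤ μ₁ * R.prefixWeight [opn 0] ∧
    R.prefixWeight b ≤ μ₂ * R.prefixWeight [opn 0]}

/-- Two positive labels appear in a common context. -/
def SameContext (G : Grammar D) (i j : ℕ) : Prop :=
  i ≠ 0 ∧ j ≠ 0 ∧ ∃ a : List (Symb D),
    0 < G.weight (a ++ [cls i]) * G.weight (a ++ [cls j]) +
      G.weight (opn i :: a) * G.weight (opn j :: a)

/-- `f` identifies the labels of `G` through context: `f` fixes `0`, and on positive labels it is
given by an indexing, by the positive integers, of the classes of the smallest equivalence relation
containing `SameContext G`. -/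
def IsContextMap (G : Grammar D) (f : ℕ → ℕ) : Prop :=
  f 0 = 0 ∧ (∀ i, i ≠ 0 → f i ≠ 0) ∧ Function.Surjective f ∧
    ∀ i j, i ≠ 0 → j ≠ 0 → (f i = f j ↔ Relation.EqvGen (SameContext G) i j)

/-- The number of labels used by `G`. -/
noncomputable def labelCount (G : Grammar D) : ℕ :=
  {i : ℕ | 0 < G.prefixWeight [cls i]}.ncard

/-- `IsIterate G K`: the grammar `K` is obtained from `G` by applying label identification through
context repeatedly, stopping as soon as one more application would leave the number of labels
unchanged. -/
inductive IsIterate : Grammar D → Grammar D → Prop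
  | halt (G H : Grammar D) (f : ℕ → ℕ) (hf : IsContextMap G f) (hH : IsImage f G H)
      (hL : H.labelCount = G.labelCount) : IsIterate G G
  | step (G H K : Grammar D) (f : ℕ → ℕ) (hf : IsContextMap G f) (hH : IsImage f G H)
      (hL : H.labelCount ≠ G.labelCount) (hK : IsIterate H K) : IsIterate G K

/-- `χ(G)`, defined up to isomorphism, as the set of all its representatives. -/
def chi (G : Grammar D) : Set (Grammar D) :=
  {K' | ∃ K, IsIterate G K ∧ Isomorphic K K'}

open Classical in
/-- The learning rule `β_ℓ(G)`. -/
noncomputable def learn (μ₁ μ₂ : ℝ) (G : Grammar D) : Set (Grammar D) :=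
  if broadParse μ₁ μ₂ G G = ∅ then innovate μ₁ μ₂ G G
  else {K | ∃ G' ∈ broadParse μ₁ μ₂ G G, K ∈ chi G'}

end Grammar

/-- The transition probabilities of a time homogeneous Markov chain on `X` that moves from `x` to
`y` with positive probability if and only if `y ∈ next x`, and that is stopped at the first
time `τ` when `next` is empty at its current state (there is no transition from such a state). -/
structure StoppedChain {X : Type*} (next : X → Set X) where
  prob : X → X → ℝ≥0∞
  pos_iff : ∀ x y, 0 < prob x y ↔ y ∈ next x
  sum_eq_one : ∀ x, (next x).Nonempty → ∑' y, prob x y = 1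

namespace StoppedChain

variable {X : Type*} {next : X → Set X}

open Classical in
/-- `ℙ(n ≤ τ, S_n = y | S_0 = x)`. -/
noncomputable def probAt (S : StoppedChain next) : ℕ → X → X → ℝ≥0∞
  | 0, x, y => if x = y then 1 else 0
  | n + 1, x, y => ∑' z, S.prob x z * S.probAt n z y

open Classical in
/-- The distribution of the final state, `ℙ(τ < ∞, S_τ = y | S_0 = x)`: the event `τ = n` is
`n ≤ τ` together with `next S_n = ∅`. -/
noncomputable def finalLaw (S : StoppedChain next) (x y : X) : ℝ≥0∞ :=
  if next y = ∅ then ∑' n, S.probAt n x y else 0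

open Classical in
/-- `ℙ(n ≤ τ, S_n = y, S_k ≠ y for all k < n | S_0 = x)`. -/
noncomputable def firstVisitAt (S : StoppedChain next) : ℕ → X → X → ℝ≥0∞
  | 0, x, y => if x = y then 1 else 0
  | n + 1, x, y => if x = y then 0 else ∑' z, S.prob x z * S.firstVisitAt n z y

/-- The probability that the chain visits `y`, `ℙ(S_n = y for some n ≤ τ | S_0 = x)`. -/
noncomputable def visitProb (S : StoppedChain next) (x y : X) : ℝ≥0∞ :=
  ∑' n, S.firstVisitAt n x y

end StoppedChain

/-- A production process. -/
abbrev ProductionProcess (D : Type*) :=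
  StoppedChain (fun G : Grammar D => G.merge)

/-- A learning process, with learning parameters `μ₁` and `μ₂`. -/
abbrev LearningProcess (D : Type*) (μ₁ μ₂ : ℝ) :=
  StoppedChain (fun G : Grammar D => G.learn μ₁ μ₂)

/-- A parsing process with reference grammar `R`. -/
abbrev ParsingProcess (R : Grammar D) :=
  StoppedChain (fun G : Grammar D => G.narrowParse R)

open Classical in
/-- The distribution of the output of a production process,
`ℙ(P_σ = T | P_0 = G, P_σ is a text)`. -/
noncomputable def ProductionProcess.textLaw (P : ProductionProcess D) (G T : Grammar D) : ℝ≥0∞ :=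
  (if T.IsText then P.finalLaw G T else 0) /
    ∑' T' : {T' : Grammar D // T'.IsText}, P.finalLaw G T'

end Toric

/-! All the claims are statements about reachability. A law of a stopped chain has positive mass at
a state exactly when a path leads there (`finalLaw_pos_iff`, `visitProb_pos_iff`). A text admits no
merge, and the normalising constant of `textLaw` is at most 1, so positivity of the text law at `T`
means that successive merges lead from `G` to `T` (`textLaw_pos_iff`).

From learning or parsing to production: every split is undone by a merge (`IsSplit.mem_merge`), so a
chain of splits from `T` to `G`, read backwards, is a chain of merges. Label identification is
harmless: relabelling sends merges to merges and fixes texts, so a whole chain of merges to `T` can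
be relabelled (`mergesTo_of_isImage`, `mergesTo_of_mem_chi`).

From production to parsing: reversed merges are splits, but narrow parsing only splits global
expressions. A merge into a local expression can be exchanged with a following merge into a global
one (`MergeAt.exchange`). Pushed to the end, it would leave a local expression in the text, which is
impossible; so all merges may be taken global (`IsText.globalMergesTo`). Global merges create no
local expression, hence every local expression they consume is already in the support of `G`, and so
in that of the reference (`reflTransGen_narrowParse`). -/

namespace Toric

/-! ### Stopped Markov chains: positivity as reachability, total mass of the final law. -/

namespace StoppedChain

variable {X : Type*} {next : X → Set X}

theorem prob_eq_zero (S : StoppedChain next) {x y : X} (h : y ∉ next x) : S.prob x y = 0 := by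
  by_contra h0
  exact h ((S.pos_iff x y).1 (pos_iff_ne_zero.2 h0))

theorem tsum_prob_mul_ne_zero_iff (S : StoppedChain next) (x : X) (g : X → ℝ≥0∞) :
    ∑' z, S.prob x z * g z ≠ 0 ↔ ∃ z ∈ next x, g z ≠ 0 := by
  simp only [ne_eq, ENNReal.tsum_eq_zero, not_forall, mul_eq_zero, not_or]
  refine exists_congr fun z => and_congr_left fun _ => ?_
  rw [← S.pos_iff x z, pos_iff_ne_zero]

theorem reflTransGen_of_probAt_ne_zero (S : StoppedChain next) (n : ℕ) :
    ∀ x y, S.probAt n x y ≠ 0 → Relation.ReflTransGen (fun x y => y ∈ next x) x y := by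
  induction n with
  | zero =>
    intro x y h
    by_cases hxy : x = y
    · subst hxy; exact .refl
    · simp [probAt, hxy] at h
  | succ n ih =>
    intro x y h
    rw [probAt, tsum_prob_mul_ne_zero_iff] at h
    obtain ⟨z, hz, h⟩ := h
    exact .head hz (ih z y h)

theorem exists_probAt_ne_zero (S : StoppedChain next) {x y : X}
    (h : Relation.ReflTransGen (fun x y => y ∈ next x) x y) : ∃ n, S.probAt n x y ≠ 0 := by
  induction h using Relation.ReflTransGen.head_induction_on with
  | refl => exact ⟨0, by simp [probAt]⟩
  | head hz _ ih =>
    obtain ⟨n, hn⟩ := ih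
    exact ⟨n + 1, by rw [probAt, tsum_prob_mul_ne_zero_iff]; exact ⟨_, hz, hn⟩⟩

theorem finalLaw_pos_iff (S : StoppedChain next) (x y : X) :
    0 < S.finalLaw x y ↔ next y = ∅ ∧ Relation.ReflTransGen (fun x y => y ∈ next x) x y := by
  by_cases hy : next y = ∅
  · simp only [finalLaw, hy, if_true, true_and, pos_iff_ne_zero, ne_eq, ENNReal.tsum_eq_zero,
      not_forall]
    exact ⟨fun ⟨n, hn⟩ => S.reflTransGen_of_probAt_ne_zero n x y hn, S.exists_probAt_ne_zero⟩
  · simp [finalLaw, hy]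

theorem reflTransGen_of_firstVisitAt_ne_zero (S : StoppedChain next) (n : ℕ) :
    ∀ x y, S.firstVisitAt n x y ≠ 0 → Relation.ReflTransGen (fun x y => y ∈ next x) x y := by
  induction n with
  | zero =>
    intro x y h
    by_cases hxy : x = y
    · subst hxy; exact .refl
    · simp [firstVisitAt, hxy] at h
  | succ n ih =>
    intro x y h
    by_cases hxy : x = y
    · subst hxy; exact .refl
    rw [firstVisitAt, if_neg hxy, tsum_prob_mul_ne_zero_iff] at h
    obtain ⟨z, hz, h⟩ := h
    exact .head hz (ih z y h)

theorem exists_firstVisitAt_ne_zero (S : StoppedChain next) {x y : X}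
    (h : Relation.ReflTransGen (fun x y => y ∈ next x) x y) :
    ∃ n, S.firstVisitAt n x y ≠ 0 := by
  induction h using Relation.ReflTransGen.head_induction_on with
  | refl => exact ⟨0, by simp [firstVisitAt]⟩
  | @head x z hz _ ih =>
    by_cases hxy : x = y
    -- A path that starts at its target is cut at time 0, the first visit.
    · exact ⟨0, by simp [firstVisitAt, hxy]⟩
    · obtain ⟨n, hn⟩ := ih
      exact ⟨n + 1, by
        rw [firstVisitAt, if_neg hxy, tsum_prob_mul_ne_zero_iff]; exact ⟨_, hz, hn⟩⟩

theorem visitProb_pos_iff (S : StoppedChain next) (x y : X) :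
    0 < S.visitProb x y ↔ Relation.ReflTransGen (fun x y => y ∈ next x) x y := by
  simp only [visitProb, pos_iff_ne_zero, ne_eq, ENNReal.tsum_eq_zero, not_forall]
  exact ⟨fun ⟨n, hn⟩ => S.reflTransGen_of_firstVisitAt_ne_zero n x y hn,
    S.exists_firstVisitAt_ne_zero⟩

open Classical in
-- The events of stopping at `y` at time `n` are disjoint. Induction on `N` by conditioning on the
-- first step: from a terminal `x` only `n = 0`, `y = x` contributes; otherwise the `n = 0` term
-- vanishes at every terminal `y`, and the rest is an average of the bounds at the successors of
-- `x`.
theorem tsum_sum_range_probAt_le_one (S : StoppedChain next) (N : ℕ) (x : X) :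
    ∑' y, (if next y = ∅ then ∑ n ∈ Finset.range N, S.probAt n x y else 0) ≤ 1 := by
  induction N generalizing x with
  | zero => simp
  | succ N ih =>
    by_cases hx : next x = ∅
    · refine le_trans (ENNReal.tsum_le_tsum (g := fun y => if y = x then 1 else 0) fun y => ?_)
        (by simp)
      have h0 : ∀ n, S.probAt (n + 1) x y = 0 := fun n => by
        rw [probAt, ENNReal.tsum_eq_zero]
        intro z
        rw [S.prob_eq_zero (by simp [hx]), zero_mul]
      rw [Finset.sum_range_succ']
      simp only [h0, Finset.sum_const_zero, zero_add]
      by_cases hxy : y = x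
      · simp only [probAt, hxy, if_true]; split_ifs <;> simp
      · simp [probAt, hxy, Ne.symm hxy]
    · have key : ∀ y, (if next y = ∅ then ∑ n ∈ Finset.range (N + 1), S.probAt n x y else 0) =
          ∑' z, S.prob x z *
            (if next y = ∅ then ∑ n ∈ Finset.range N, S.probAt n z y else 0) := by
        intro y
        by_cases hy : next y = ∅
        · have hxy : x ≠ y := fun h => hx (h ▸ hy)
          simp only [hy, if_true, Finset.sum_range_succ', Finset.mul_sum]
          rw [Summable.tsum_finsetSum fun _ _ => ENNReal.summable]
          simp [probAt, hxy]
        · simp [hy]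
      simp only [key]
      rw [ENNReal.tsum_comm]
      simp only [ENNReal.tsum_mul_left]
      calc ∑' z, S.prob x z *
            ∑' y, (if next y = ∅ then ∑ n ∈ Finset.range N, S.probAt n z y else 0)
          ≤ ∑' z, S.prob x z * 1 := ENNReal.tsum_le_tsum fun z => by gcongr; exact ih z
        _ = 1 := by
          simp only [mul_one]
          exact S.sum_eq_one x (Set.nonempty_iff_ne_empty.2 hx)

theorem tsum_finalLaw_le_one (S : StoppedChain next) (x : X) : ∑' y, S.finalLaw x y ≤ 1 := by
  classical
  have h : ∀ y, S.finalLaw x y =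
      ∑' n, (if next y = ∅ then S.probAt n x y else 0) := fun y => by
    unfold finalLaw; split_ifs <;> simp
  simp only [h]
  rw [ENNReal.tsum_comm, ENNReal.tsum_eq_iSup_nat]
  refine iSup_le fun N => ?_
  rw [← Summable.tsum_finsetSum fun _ _ => ENNReal.summable]
  refine le_trans (le_of_eq (tsum_congr fun y => ?_)) (S.tsum_sum_range_probAt_le_one N x)
  split_ifs <;> simp

end StoppedChain

/-! ### Expressions as circular words with one opening bracket, and their orbits. -/

open Symb

variable {D : Type*}

theorem isRotated_iff_append {α : Type*} {l l' : List α} :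
    l ~r l' ↔ ∃ u v, l = u ++ v ∧ l' = v ++ u := by
  constructor
  · intro h
    obtain ⟨n, hn, rfl⟩ := List.isRotated_iff_mod.1 h
    exact ⟨l.take n, l.drop n, by simp, List.rotate_eq_drop_append_take hn⟩
  · rintro ⟨u, v, rfl, rfl⟩
    exact List.isRotated_append

/-- Nonempty sequences of words and closing brackets with positive labels, not reduced to a single
closing bracket. -/
def IsBody (a : List (Symb D)) : Prop :=
  a ≠ [] ∧ (∀ s ∈ a, (∃ w, s = word w) ∨ ∃ j, j ≠ 0 ∧ s = cls j) ∧ ¬ ∃ j, j ≠ 0 ∧ a = [cls j]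

theorem IsBody.opn_notMem {a : List (Symb D)} (h : IsBody a) (k : ℕ) : opn k ∉ a := fun hk => by
  rcases h.2.1 _ hk with ⟨w, hw⟩ | ⟨j, _, hj⟩ <;> simp_all

theorem IsBody.isExpr {a : List (Symb D)} (h : IsBody a) (k : ℕ) : IsExpr (opn k :: a) :=
  ⟨k, a, List.IsRotated.refl _, h.1, h.2.1, h.2.2⟩

theorem IsExpr.of_isRotated {e e' : List (Symb D)} (h : IsExpr e) (hr : e' ~r e) : IsExpr e' := by
  obtain ⟨k, a, ha, hb⟩ := h
  exact ⟨k, a, hr.trans ha, hb⟩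

/-- An expression has a single opening bracket, at which it can be cut. -/
theorem exists_append_of_isRotated {k : ℕ} {a e : List (Symb D)} (h : e ~r (opn k :: a)) :
    ∃ u v, e = u ++ opn k :: v ∧ a = v ++ u := by
  obtain ⟨p, q, rfl, hpq⟩ := isRotated_iff_append.1 h
  rcases q with _ | ⟨s, q⟩
  · simp only [List.nil_append] at hpq
    exact ⟨[], a, by simp [← hpq]⟩
  · simp only [List.cons_append, List.cons.injEq] at hpq
    exact ⟨p, q, by simp [hpq.1], hpq.2⟩

theorem isRotated_opn_cons {k : ℕ} {u v : List (Symb D)} :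
    (u ++ opn k :: v) ~r (opn k :: (v ++ u)) := by
  simpa using List.isRotated_append (l := u) (l' := opn k :: v)

/-- A body contains no opening bracket, so the cut at the opening bracket is unique. -/
theorem IsBody.eq_of_append_eq {k l : ℕ} {u v p q : List (Symb D)} (h : IsBody (v ++ u))
    (he : u ++ opn k :: v = p ++ opn l :: q) : k = l ∧ u = p ∧ v = q := by
  have hu : ∀ m, opn m ∉ u := fun m hm => h.opn_notMem m (List.mem_append_right _ hm)
  have hv : ∀ m, opn m ∉ v := fun m hm => h.opn_notMem m (List.mem_append_left _ hm)
  rcases List.append_eq_append_iff.1 he with ⟨c, h1, h2⟩ | ⟨c, h1, h2⟩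
  · rcases c with _ | ⟨s, c⟩
    · simp at h1 h2
      exact ⟨h2.1, h1.symm, h2.2⟩
    · simp at h2
      exact absurd (by simp [h2.2]) (hv l)
  · rcases c with _ | ⟨s, c⟩
    · simp at h1 h2
      exact ⟨h2.1.symm, h1, h2.2.symm⟩
    · simp at h2
      exact absurd (by simp [h1, h2.1]) (hu l)

/-- The rotation that starts at the only opening bracket is a canonical representative of a circular
expression. -/
theorem IsBody.eq_of_isRotated {k l : ℕ} {a b : List (Symb D)} (h : IsBody a)
    (hr : (opn k :: a) ~r (opn l :: b)) : k = l ∧ a = b := by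
  obtain ⟨u, v, he, rfl⟩ := exists_append_of_isRotated hr
  obtain ⟨h1, rfl, rfl⟩ := IsBody.eq_of_append_eq (u := []) (by simpa using h) he
  exact ⟨h1, by simp⟩

theorem isExpr_append_opn {k : ℕ} {u v : List (Symb D)} :
    IsExpr (u ++ opn k :: v) ↔ IsBody (v ++ u) := by
  constructor
  · rintro ⟨l, a, hr, ha⟩
    have := IsBody.eq_of_isRotated ha (hr.symm.trans isRotated_opn_cons)
    exact this.2 ▸ ha
  · exact fun h => ⟨k, _, isRotated_opn_cons, h⟩

theorem isExpr_opn_cons {k : ℕ} {a : List (Symb D)} : IsExpr (opn k :: a) ↔ IsBody a := by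
  simpa using isExpr_append_opn (k := k) (u := []) (v := a)

theorem IsBody.isGlobal_iff {k : ℕ} {a e : List (Symb D)} (h : IsBody a)
    (he : e ~r (opn k :: a)) : IsGlobal e ↔ k = 0 := by
  constructor
  · rintro ⟨_, b, _, hb⟩
    exact (h.eq_of_isRotated (he.symm.trans hb)).1
  · rintro rfl
    exact ⟨⟨0, a, he, h⟩, a, h.1, he⟩

theorem IsBody.isLocal_iff {k : ℕ} {a e : List (Symb D)} (h : IsBody a)
    (he : e ~r (opn k :: a)) : IsLocal e ↔ k ≠ 0 := by
  constructor
  · rintro ⟨_, l, b, hl, _, hb⟩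
    rwa [(h.eq_of_isRotated (he.symm.trans hb)).1]
  · exact fun hk => ⟨⟨k, a, he, h⟩, k, a, hk, h.1, he⟩

open Classical in
theorem orbit_apply (e s : List (Symb D)) : orbit e s = if s ~r e then 1 else 0 := by
  simp only [orbit, Finsupp.finsetSum_apply, Finsupp.single_apply, Finset.sum_ite_eq',
    List.mem_toFinset, List.mem_cyclicPermutations_iff]

theorem orbit_nonneg (e s : List (Symb D)) : 0 ≤ orbit e s := by
  classical
  rw [orbit_apply]; split_ifs <;> norm_num

theorem orbit_apply_self (e : List (Symb D)) : orbit e e = 1 := by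
  classical
  rw [orbit_apply, if_pos (List.IsRotated.refl _)]

theorem orbit_ne_zero_iff {e s : List (Symb D)} : orbit e s ≠ 0 ↔ s ~r e := by
  classical
  rw [orbit_apply]; split_ifs <;> simp [*]

theorem orbit_congr {e e' : List (Symb D)} (h : e ~r e') : orbit e = orbit e' := by
  classical
  ext s
  simp only [orbit_apply]
  exact if_congr ⟨fun hs => hs.trans h, fun hs => hs.trans h.symm⟩ rfl rfl

theorem orbit_apply_congr (e : List (Symb D)) {s s' : List (Symb D)} (h : s ~r s') :
    orbit e s = orbit e s' := by
  classical
  simp only [orbit_apply]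
  exact if_congr ⟨fun hs => h.symm.trans hs, fun hs => h.trans hs⟩ rfl rfl

theorem orbit_append_opn {k : ℕ} {u v : List (Symb D)} :
    orbit (u ++ opn k :: v) = orbit (opn k :: (v ++ u)) :=
  orbit_congr isRotated_opn_cons

/-- The orbits of distinct expressions are disjoint. -/
theorem IsBody.orbit_eq_zero_or {k l : ℕ} {a b : List (Symb D)} (h : IsBody a)
    (hne : ¬ (k = l ∧ a = b)) (s : List (Symb D)) :
    orbit (opn k :: a) s = 0 ∨ orbit (opn l :: b) s = 0 := by
  by_contra! hc
  exact hne (h.eq_of_isRotated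
    ((orbit_ne_zero_iff.1 hc.1).symm.trans (orbit_ne_zero_iff.1 hc.2)))

/-! ### Relabelling -/

theorem IsBody.map_relabel {f : ℕ → ℕ} (hf : ∀ i, i ≠ 0 → f i ≠ 0) {a : List (Symb D)}
    (h : IsBody a) : IsBody (a.map (Symb.relabel f)) := by
  refine ⟨by simpa using h.1, ?_, ?_⟩
  · intro s hs
    obtain ⟨t, ht, rfl⟩ := List.mem_map.1 hs
    rcases h.2.1 t ht with ⟨w, rfl⟩ | ⟨j, hj, rfl⟩
    · exact Or.inl ⟨w, rfl⟩
    · exact Or.inr ⟨f j, hf j hj, rfl⟩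
  · rintro ⟨j, hj, hm⟩
    obtain ⟨t, rfl, ht⟩ := List.map_eq_singleton_iff.1 hm
    rcases h.2.1 t (by simp) with ⟨w, rfl⟩ | ⟨l, hl, rfl⟩
    · simp [Symb.relabel] at ht
    · exact h.2.2 ⟨l, hl, rfl⟩

theorem IsExpr.map_relabel {f : ℕ → ℕ} (hf : ∀ i, i ≠ 0 → f i ≠ 0) {e : List (Symb D)}
    (h : IsExpr e) : IsExpr (e.map (Symb.relabel f)) := by
  obtain ⟨k, a, hr, ha⟩ := h
  exact ⟨f k, _, by simpa [Symb.relabel] using hr.map (Symb.relabel f), IsBody.map_relabel hf ha⟩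

/-- The image of an orbit: the rotations of an expression remain distinct after relabelling, because
it has a single opening bracket. -/
theorem IsBody.mapDomain_orbit {f : ℕ → ℕ} (hf : ∀ i, i ≠ 0 → f i ≠ 0) {k : ℕ}
    {a : List (Symb D)} (h : IsBody a) :
    (orbit (opn k :: a)).mapDomain (List.map (Symb.relabel f)) =
      orbit (opn (f k) :: a.map (Symb.relabel f)) := by
  classical
  have hinj : Set.InjOn (List.map (Symb.relabel f))
      ((opn k :: a).cyclicPermutations.toFinset : Set (List (Symb D))) := by
    intro s hs t ht hst
    simp only [List.coe_toFinset, Set.mem_ofPred_eq, List.mem_cyclicPermutations_iff] at hs ht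
    obtain ⟨u, v, rfl, huv⟩ := exists_append_of_isRotated hs
    obtain ⟨p, q, rfl, hpq⟩ := exists_append_of_isRotated ht
    have hb := (huv ▸ h).map_relabel hf
    simp only [List.map_append, List.map_cons, Symb.relabel] at hst hb
    obtain ⟨-, hup, -⟩ := hb.eq_of_append_eq hst
    -- The label map may identify symbols, but the position of the opening bracket survives;
    -- together with `a` it determines the rotation.
    have hl : u.length = p.length := by simpa using congrArg List.length hup
    obtain ⟨rfl, rfl⟩ := List.append_inj' (huv.symm.trans hpq) hl
    rfl
  rw [orbit, orbit, Finsupp.mapDomain_finsetSum]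
  simp only [Finsupp.mapDomain_single]
  rw [← Finset.sum_image (f := fun s => Finsupp.single s (1 : ℝ)) hinj]
  congr 1
  ext s
  simp only [Finset.mem_image, List.mem_toFinset, List.mem_cyclicPermutations_iff]
  constructor
  · rintro ⟨t, ht, rfl⟩
    simpa [Symb.relabel] using ht.map (Symb.relabel f)
  · intro hs
    obtain ⟨n, rfl⟩ := hs.symm
    exact ⟨(opn k :: a).rotate n, (List.IsRotated.forall _ n), by
      simp [List.map_rotate, Symb.relabel]⟩

namespace Grammar

/-- Rotation invariance expressed through image measures, a form that passes through relabelling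
because relabelling commutes with rotations. -/
theorem mapDomain_rotate (G : Grammar D) (n : ℕ) :
    G.weight.mapDomain (fun e => e.rotate n) = G.weight := by
  have hinj : Function.Injective (fun e : List (Symb D) => e.rotate n) := List.rotate_injective n
  ext e
  obtain ⟨m, hm⟩ := (List.IsRotated.forall e n)
  have he : (e.rotate m).rotate n = e := by
    rw [List.rotate_rotate, Nat.add_comm, ← List.rotate_rotate]; exact hm
  calc G.weight.mapDomain (fun e => e.rotate n) e
      = G.weight.mapDomain (fun e => e.rotate n) ((e.rotate m).rotate n) := by rw [he]
    _ = G.weight (e.rotate m) := Finsupp.mapDomain_apply hinj _ _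
    _ = G.weight e := G.rotate _ _ (List.IsRotated.forall e m)

/-- The image of a grammar by a label map. -/
noncomputable def relabel (f : ℕ → ℕ) (hf : ∀ i, i ≠ 0 → f i ≠ 0) (G : Grammar D) : Grammar D where
  weight := G.weight.mapDomain (List.map (Symb.relabel f))
  nonneg e := by
    classical
    rw [Finsupp.mapDomain, Finsupp.sum, Finsupp.finsetSum_apply]
    refine Finset.sum_nonneg fun s _ => ?_
    rw [Finsupp.single_apply]
    split_ifs
    · exact G.nonneg s
    · exact le_rfl
  isExpr e he := by
    classical
    have := Finsupp.mapDomain_support (Finsupp.mem_support_iff.2 he)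
    obtain ⟨s, hs, rfl⟩ := Finset.mem_image.1 this
    exact (G.isExpr s (Finsupp.mem_support_iff.1 hs)).map_relabel hf
  rotate e e' h := by
    obtain ⟨n, rfl⟩ := h.symm
    have hinj : Function.Injective (fun e : List (Symb D) => e.rotate n) :=
      List.rotate_injective n
    have hc : List.map (Symb.relabel f) ∘ (fun e : List (Symb D) => e.rotate n) =
        (fun e : List (Symb D) => e.rotate n) ∘ List.map (Symb.relabel f) := by
      funext s; simp [List.map_rotate]
    conv_lhs => rw [← G.mapDomain_rotate n, ← Finsupp.mapDomain_comp, hc, Finsupp.mapDomain_comp]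
    exact Finsupp.mapDomain_apply hinj _ _

/-! ### Merges in normal form -/

/-- `G' = G ⊖ [_k x ]_i y ⊖ [_i b ⊕ [_k x b y`. -/
def MergeAt (k i : ℕ) (x y b : List (Symb D)) (G G' : Grammar D) : Prop :=
  IsBody (x ++ cls i :: y) ∧ IsBody b ∧
    G'.weight = G.weight - orbit (opn k :: (x ++ cls i :: y)) - orbit (opn i :: b)
      + orbit (opn k :: (x ++ b ++ y))

theorem isBody_append_append {i : ℕ} {x y b : List (Symb D)} (h : IsBody (x ++ cls i :: y))
    (hb : IsBody b) : IsBody (x ++ b ++ y) := by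
  refine ⟨by simp [hb.1], ?_, ?_⟩
  · intro s hs
    simp only [List.mem_append] at hs
    rcases hs with (hs | hs) | hs
    · exact h.2.1 s (by simp [hs])
    · exact hb.2.1 s hs
    · exact h.2.1 s (by simp [hs])
  · rintro ⟨j, hj, he⟩
    have hl := congrArg List.length he
    have hb0 := List.length_pos_of_ne_nil hb.1
    simp only [List.length_append, List.length_singleton] at hl
    have hx : x = [] := List.eq_nil_of_length_eq_zero (by omega)
    have hy : y = [] := List.eq_nil_of_length_eq_zero (by omega)
    subst hx hy
    exact hb.2.2 ⟨j, hj, by simpa using he⟩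

/-- Consequently the expression `[_i b` inserted by a merge is always local. -/
theorem label_ne_zero {i : ℕ} {x y : List (Symb D)} (h : IsBody (x ++ cls i :: y)) : i ≠ 0 := by
  rcases h.2.1 (cls i) (by simp) with ⟨w, hw⟩ | ⟨j, hj, hi⟩
  · cases hw
  · cases hi; exact hj

/-- The opening bracket of `a ]_i` lies in `a`, so `a = y [_k x`; rotating to start at it gives `[_k
x ]_i y`. The condition that `ab` be an expression is then automatic. -/
theorem mem_merge_iff {G G' : Grammar D} :
    G' ∈ G.merge ↔ ∃ k i x y b, MergeAt k i x y b G G' := by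
  constructor
  · rintro ⟨i, a, b, ha, hb, -, hw⟩
    obtain ⟨k, c, hr, -⟩ := id ha
    obtain ⟨u, v, he, -⟩ := exists_append_of_isRotated hr
    rcases List.eq_nil_or_concat v with rfl | ⟨v, s, rfl⟩
    · exact absurd (congrArg List.getLast? he) (by simp)
    · have h2 : a = u ++ opn k :: v ∧ cls i = s := by
        have : a ++ [cls i] = (u ++ opn k :: v) ++ [s] := by simpa using he
        simpa using List.append_inj' this rfl
      obtain ⟨rfl, rfl⟩ := h2
      have e1 : u ++ opn k :: v ++ [cls i] = u ++ opn k :: (v ++ [cls i]) := by simp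
      have e2 : u ++ opn k :: v ++ b = u ++ opn k :: (v ++ b) := by simp
      rw [e1, isExpr_append_opn] at ha
      rw [e1, e2, orbit_append_opn, orbit_append_opn] at hw
      refine ⟨k, i, v, u, b, by simpa using ha, isExpr_opn_cons.1 hb, by simpa using hw⟩
  · rintro ⟨k, i, x, y, b, ha, hb, hw⟩
    have e1 : y ++ opn k :: x ++ [cls i] = y ++ opn k :: (x ++ [cls i]) := by simp
    have e2 : y ++ opn k :: x ++ b = y ++ opn k :: (x ++ b) := by simp
    refine ⟨i, y ++ opn k :: x, b, ?_, hb.isExpr i, ?_, ?_⟩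
    · rw [e1, isExpr_append_opn]; simpa using ha
    · rw [e2, isExpr_append_opn]; exact isBody_append_append ha hb
    · rw [e1, e2, orbit_append_opn, orbit_append_opn]; simpa using hw

theorem IsSplit.mem_merge {G G' : Grammar D} {i : ℕ} {a b : List (Symb D)}
    (h : IsSplit G G' i a b) : G ∈ G'.merge := by
  obtain ⟨h1, h2, h3, hw⟩ := h
  exact ⟨i, a, b, h2, h3, h1, by rw [hw]; abel⟩

theorem append_cls_cons_ne {i : ℕ} (hi : i ≠ 0) {x y b : List (Symb D)} (hb : IsBody b) :
    x ++ cls i :: y ≠ x ++ b ++ y := by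
  intro he
  rw [List.append_assoc, List.append_cancel_left_eq, ← List.singleton_append,
    List.append_cancel_right_eq] at he
  exact hb.2.2 ⟨i, hi, he.symm⟩

/-- The merged expressions are present in the grammar. -/
theorem MergeAt.orbit_add_le {k i : ℕ} {x y b : List (Symb D)} {G G' : Grammar D}
    (h : MergeAt k i x y b G G') (e : List (Symb D)) :
    orbit (opn k :: (x ++ cls i :: y)) e + orbit (opn i :: b) e ≤ G.weight e := by
  obtain ⟨ha, hb, hw⟩ := h
  have h0 := G'.nonneg e
  rw [hw] at h0
  simp only [Finsupp.add_apply, Finsupp.sub_apply] at h0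
  have hg := G.nonneg e
  have hi := label_ne_zero ha
  -- The added orbit is disjoint from both removed ones, so it cannot hide a deficit of `G`:
  -- nonnegativity of `G'` gives the bound. It is stated for the sum because the two removed
  -- expressions may coincide.
  have h1 := ha.orbit_eq_zero_or (k := k) (l := k) (b := x ++ b ++ y)
    (fun hc => append_cls_cons_ne hi hb hc.2) e
  have h2 := hb.orbit_eq_zero_or (k := i) (l := k) (b := x ++ b ++ y) (fun hc => by
    have hl := congrArg List.length hc.2
    simp only [List.length_append] at hl
    have hx : x = [] := List.eq_nil_of_length_eq_zero (by omega)
    have hy : y = [] := List.eq_nil_of_length_eq_zero (by omega)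
    subst hx hy
    exact ha.2.2 ⟨i, hi, by simp⟩) e
  rcases h1 with h1 | h1 <;> rcases h2 with h2 | h2 <;> linarith

theorem exists_mergeAt {k i : ℕ} {x y b : List (Symb D)} {G : Grammar D}
    (ha : IsBody (x ++ cls i :: y)) (hb : IsBody b)
    (h : ∀ e, orbit (opn k :: (x ++ cls i :: y)) e + orbit (opn i :: b) e ≤ G.weight e) :
    ∃ G', MergeAt k i x y b G G' := by
  refine ⟨⟨G.weight - orbit (opn k :: (x ++ cls i :: y)) - orbit (opn i :: b)
      + orbit (opn k :: (x ++ b ++ y)), ?_, ?_, ?_⟩, ha, hb, rfl⟩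
  · intro e
    simp only [Finsupp.add_apply, Finsupp.sub_apply]
    linarith [h e, orbit_nonneg (opn k :: (x ++ b ++ y)) e]
  · intro e he
    by_contra hc
    have h0 : ∀ l c, IsBody c → orbit (opn l :: c) e = 0 := fun l c hcb => by
      by_contra hne
      exact hc ((hcb.isExpr l).of_isRotated (orbit_ne_zero_iff.1 hne))
    have hG : G.weight e = 0 := by
      by_contra hne
      exact hc (G.isExpr e hne)
    simp only [Finsupp.add_apply, Finsupp.sub_apply, h0 _ _ ha, h0 _ _ hb,
      h0 _ _ (isBody_append_append ha hb), hG, sub_zero, add_zero, ne_eq, not_true] at he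
  · intro e e' hr
    simp only [Finsupp.add_apply, Finsupp.sub_apply, orbit_apply_congr _ hr, G.rotate e e' hr]

/-- A merge into a local expression can be postponed after a merge into a global one. -/
theorem MergeAt.exchange {k i j : ℕ} {x y b p q d : List (Symb D)} {G G₁ G₂ : Grammar D}
    (hk : k ≠ 0) (h₁ : MergeAt k i x y b G G₁) (h₂ : MergeAt 0 j p q d G₁ G₂) :
    ∃ G', (∃ j p q d, MergeAt 0 j p q d G G') ∧ ∃ k i x y b, MergeAt k i x y b G' G₂ := by
  have l₁ := h₁.orbit_add_le
  have l₂ := h₂.orbit_add_le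
  obtain ⟨ha, hb, hw₁⟩ := h₁
  obtain ⟨hc, hd, hw₂⟩ := h₂
  have hab := isBody_append_append ha hb
  rw [hw₁] at l₂
  simp only [Finsupp.add_apply, Finsupp.sub_apply] at l₂
  -- If the second merge inserts the expression just created, insert its unmerged form `[_k x ]_i y`
  -- first and replace `]_i` by `b` afterwards, inside a global expression. Otherwise the second
  -- merge does not use the first one's output (its receiver is global, the output local), and the
  -- two commute.
  by_cases hcase : j = k ∧ d = x ++ b ++ y
  · obtain ⟨rfl, rfl⟩ := hcase
    obtain ⟨G', hG'⟩ := exists_mergeAt (k := 0) (G := G) hc ha (fun e => by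
      have hx := hc.orbit_eq_zero_or (k := 0) (l := j) (b := x ++ cls i :: y)
        (fun h => hk h.1.symm) e
      have := l₁ e
      have := l₂ e
      have := orbit_nonneg (opn j :: (x ++ cls i :: y)) e
      have := orbit_nonneg (opn i :: b) e
      rcases hx with hx | hx <;> linarith)
    refine ⟨G', ⟨_, _, _, _, hG'⟩, 0, i, p ++ x, y ++ q, b, ?_, hb, ?_⟩
    · simpa using isBody_append_append hc ha
    · rw [hw₂, hw₁, hG'.2.2]
      simp only [List.append_assoc, List.cons_append]
      abel
  · obtain ⟨G', hG'⟩ := exists_mergeAt (k := 0) (G := G) hc hd (fun e => by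
      have h1 := hc.orbit_eq_zero_or (k := 0) (l := k) (b := x ++ b ++ y)
        (fun h => hk h.1.symm) e
      have h2 := hd.orbit_eq_zero_or (k := j) (l := k) (b := x ++ b ++ y) hcase e
      have := l₁ e
      have := l₂ e
      have := G.nonneg e
      have := orbit_nonneg (opn k :: (x ++ cls i :: y)) e
      have := orbit_nonneg (opn i :: b) e
      rcases h1 with h1 | h1 <;> rcases h2 with h2 | h2 <;> linarith)
    refine ⟨G', ⟨_, _, _, _, hG'⟩, k, i, x, y, b, ha, hb, ?_⟩
    rw [hw₂, hw₁, hG'.2.2]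
    abel

/-! ### Texts -/

theorem IsText.merge_eq_empty {T : Grammar D} (hT : T.IsText) : T.merge = ∅ := by
  refine Set.eq_empty_iff_forall_notMem.2 fun G' hG' => ?_
  obtain ⟨k, i, x, y, b, h⟩ := mem_merge_iff.1 hG'
  have hl := h.orbit_add_le (opn k :: (x ++ cls i :: y))
  rw [orbit_apply_self] at hl
  have hne : T.weight (opn k :: (x ++ cls i :: y)) ≠ 0 := by
    linarith [orbit_nonneg (opn i :: b) (opn k :: (x ++ cls i :: y))]
  obtain ⟨ws, -, hr⟩ := hT.2 _ hne
  have : cls i ∈ opn 0 :: ws.map word := hr.perm.subset (by simp)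
  simp at this

theorem IsText.mapDomain_relabel {T : Grammar D} (hT : T.IsText) {f : ℕ → ℕ} (h0 : f 0 = 0) :
    T.weight.mapDomain (List.map (Symb.relabel f)) = T.weight := by
  have : T.weight.mapDomain (List.map (Symb.relabel f)) = T.weight.mapDomain id := by
    refine Finsupp.mapDomain_congr fun e he => ?_
    obtain ⟨ws, -, hr⟩ := hT.2 e (Finsupp.mem_support_iff.1 he)
    rw [id]
    conv_rhs => rw [← List.map_id e]
    refine List.map_congr_left fun s hs => ?_
    have := hr.perm.subset hs
    simp only [List.mem_cons, List.mem_map] at this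
    rcases this with rfl | ⟨w, -, rfl⟩ <;> simp [Symb.relabel, h0]
  rw [this, Finsupp.mapDomain_id]

/-- `T` is obtained from `G` by successive merges. -/
abbrev MergesTo : Grammar D → Grammar D → Prop :=
  Relation.ReflTransGen fun G G' => G' ∈ G.merge

/-- `T` is obtained from `G` by successive merges into global expressions. -/
abbrev GlobalMergesTo : Grammar D → Grammar D → Prop :=
  Relation.ReflTransGen fun G G' => ∃ i x y b, MergeAt 0 i x y b G G'

/-- A local first merge is exchanged with each global merge in turn, until it becomes global or
comes last; the last merge creates an expression of the text `T`, hence is global. -/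
theorem IsText.globalMergesTo_of_mem_merge {T G G₁ : Grammar D} (hT : T.IsText)
    (h : G₁ ∈ G.merge) (h₁ : GlobalMergesTo G₁ T) : GlobalMergesTo G T := by
  induction h₁ using Relation.ReflTransGen.head_induction_on generalizing G with
  | refl =>
    obtain ⟨k, i, x, y, b, hm⟩ := mem_merge_iff.1 h
    have hl := hm.orbit_add_le (opn k :: (x ++ b ++ y))
    obtain ⟨ha, hb, hw⟩ := id hm
    have hne : T.weight (opn k :: (x ++ b ++ y)) ≠ 0 := by
      rw [hw]
      simp only [Finsupp.add_apply, Finsupp.sub_apply, orbit_apply_self]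
      linarith
    obtain ⟨ws, -, hr⟩ := hT.2 _ hne
    obtain ⟨rfl, -⟩ := (isBody_append_append ha hb).eq_of_isRotated hr
    exact .single ⟨i, x, y, b, hm⟩
  | head h12 h2 ih =>
    obtain ⟨k, i, x, y, b, hm⟩ := mem_merge_iff.1 h
    by_cases hk : k = 0
    · subst hk
      exact .head ⟨i, x, y, b, hm⟩ (.head h12 h2)
    · obtain ⟨j, p, q, d, hm2⟩ := h12
      obtain ⟨G', hG', hG2⟩ := hm.exchange hk hm2
      exact .head hG' (ih (mem_merge_iff.2 hG2))

theorem IsText.globalMergesTo {T G : Grammar D} (hT : T.IsText) (h : MergesTo G T) :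
    GlobalMergesTo G T := by
  induction h using Relation.ReflTransGen.head_induction_on with
  | refl => exact .refl
  | head h1 _ ih => exact hT.globalMergesTo_of_mem_merge h1 ih

theorem GlobalMergesTo.reflTransGen_narrowParse {T G R : Grammar D} (h : GlobalMergesTo G T)
    (hR : ∀ e, G.weight e ≠ 0 → IsLocal e → R.weight e ≠ 0) :
    Relation.ReflTransGen (fun G G' : Grammar D => G' ∈ G.narrowParse R) T G := by
  induction h using Relation.ReflTransGen.head_induction_on with
  | refl => exact .refl
  | @head G G₁ h1 _ ih =>
    obtain ⟨i, x, y, b, hm⟩ := h1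
    have hle := hm.orbit_add_le
    obtain ⟨ha, hb, hw⟩ := id hm
    have hab := isBody_append_append ha hb
    -- The support condition passes to `G₁`: the expression created is global, so a local expression
    -- absent from `G` stays absent.
    refine .tail (ih fun e he hloc => hR e (fun hG => he ?_) hloc) ?_
    · rw [hw]
      have h1 := hle e
      have h2 := orbit_nonneg (opn 0 :: (x ++ cls i :: y)) e
      have h3 := orbit_nonneg (opn i :: b) e
      have h4 : orbit (opn 0 :: (x ++ b ++ y)) e = 0 := by
        by_contra hne
        exact (hab.isLocal_iff (orbit_ne_zero_iff.1 hne)).1 hloc rfl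
      simp only [Finsupp.add_apply, Finsupp.sub_apply]
      linarith
    · have e1 : y ++ opn 0 :: x ++ [cls i] = y ++ opn 0 :: (x ++ [cls i]) := by simp
      have e2 : y ++ opn 0 :: x ++ b = y ++ opn 0 :: (x ++ b) := by simp
      refine ⟨i, y ++ opn 0 :: x, b, ⟨?_, ?_, hb.isExpr i, ?_⟩, ?_, ?_⟩
      · rw [e2, isExpr_append_opn]; exact hab
      · rw [e1, isExpr_append_opn]; simpa using ha
      · rw [e1, e2, orbit_append_opn, orbit_append_opn, hw]
        simp only [List.append_assoc, List.singleton_append]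
        abel
      · rw [e2]
        exact (hab.isGlobal_iff isRotated_opn_cons).2 rfl
      · refine lt_of_le_of_ne (R.nonneg _) (Ne.symm (hR _ ?_ ?_))
        · have h1 := hle (opn i :: b)
          rw [orbit_apply_self] at h1
          linarith [orbit_nonneg (opn 0 :: (x ++ cls i :: y)) (opn i :: b)]
        · exact (hb.isLocal_iff (List.IsRotated.refl _)).2 (label_ne_zero ha)

theorem mergesTo_of_reflTransGen_narrowParse {T G R : Grammar D}
    (h : Relation.ReflTransGen (fun G G' : Grammar D => G' ∈ G.narrowParse R) T G) :
    MergesTo G T := by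
  induction h with
  | refl => exact .refl
  | tail _ h ih =>
    obtain ⟨i, a, b, hs, -⟩ := h
    exact .head hs.mem_merge ih

/-! ### Learning -/

theorem MergeAt.relabel {k i : ℕ} {x y b : List (Symb D)} {G G' : Grammar D}
    (h : MergeAt k i x y b G G') (f : ℕ → ℕ) (hf : ∀ i, i ≠ 0 → f i ≠ 0) :
    MergeAt (f k) (f i) (x.map (Symb.relabel f)) (y.map (Symb.relabel f))
      (b.map (Symb.relabel f)) (G.relabel f hf) (G'.relabel f hf) := by
  obtain ⟨ha, hb, hw⟩ := h
  refine ⟨by simpa [Symb.relabel] using ha.map_relabel hf, hb.map_relabel hf, ?_⟩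
  -- Written without subtraction, so that additivity of image measures suffices.
  have hadd : G'.weight + orbit (opn k :: (x ++ cls i :: y)) + orbit (opn i :: b) =
      G.weight + orbit (opn k :: (x ++ b ++ y)) := by rw [hw]; abel
  have := congrArg (Finsupp.mapDomain (List.map (Symb.relabel f))) hadd
  simp only [Finsupp.mapDomain_add] at this
  rw [ha.mapDomain_orbit hf, hb.mapDomain_orbit hf,
    (isBody_append_append ha hb).mapDomain_orbit hf] at this
  simp only [List.map_append, List.map_cons, Symb.relabel] at this
  change G'.weight.mapDomain _ = G.weight.mapDomain _ - _ - _ + _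
  rw [sub_sub, sub_add_eq_add_sub, eq_sub_iff_add_eq, ← add_assoc]
  exact this

/-- The whole chain of merges is relabelled; its end does not move, since `[_0` is the only bracket
in a text. -/
theorem IsText.mergesTo_of_isImage {T G K : Grammar D} (hT : T.IsText) (h : MergesTo G T)
    {f : ℕ → ℕ} (h0 : f 0 = 0) (hf : ∀ i, i ≠ 0 → f i ≠ 0) (hK : IsImage f G K) :
    MergesTo K T := by
  induction h using Relation.ReflTransGen.head_induction_on generalizing K with
  | refl =>
    have : K = T := Grammar.ext (hK.trans (hT.mapDomain_relabel h0))
    rw [this]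
  | @head G G₁ h1 _ ih =>
    have hKG : K = G.relabel f hf := Grammar.ext hK
    obtain ⟨k, i, x, y, b, hm⟩ := mem_merge_iff.1 h1
    exact .head (b := G₁.relabel f hf)
      (mem_merge_iff.2 ⟨_, _, _, _, _, hKG ▸ hm.relabel f hf⟩) (ih rfl)

theorem IsText.mergesTo_of_mem_chi {T G K : Grammar D} (hT : T.IsText) (h : MergesTo G T)
    (hK : K ∈ G.chi) : MergesTo K T := by
  obtain ⟨K', hit, f, h0, hbij, him⟩ := hK
  have hK' : MergesTo K' T := by
    induction hit with
    | halt => exact h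
    | step G H K f hf hH _ _ ih => exact ih (hT.mergesTo_of_isImage h hf.1 hf.2.1 hH) him
  exact hT.mergesTo_of_isImage hK' h0 (fun i hi hfi => hi (hbij.1 (hfi.trans h0.symm))) him

theorem IsText.mergesTo_of_reflTransGen_learn {T G : Grammar D} {μ₁ μ₂ : ℝ} (hT : T.IsText)
    (h : Relation.ReflTransGen (fun G G' : Grammar D => G' ∈ G.learn μ₁ μ₂) T G) :
    MergesTo G T := by
  induction h with
  | refl => exact .refl
  | tail _ h ih =>
    unfold learn at h
    split_ifs at h
    · obtain ⟨i, a, b, hs, -⟩ := h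
      exact .head hs.mem_merge ih
    · obtain ⟨G', ⟨i, a, b, hs, -⟩, hK⟩ := h
      exact hT.mergesTo_of_mem_chi (.head hs.mem_merge ih) hK

end Grammar

/-- In `ℝ≥0∞` a quotient is positive when its numerator is nonzero and its denominator finite;
finiteness comes from `tsum_finalLaw_le_one`. -/
theorem ProductionProcess.textLaw_pos_iff (P : ProductionProcess D) {G T : Grammar D}
    (hT : T.IsText) : 0 < P.textLaw G T ↔ G.MergesTo T := by
  have hfin : ∑' T' : {T' : Grammar D // T'.IsText}, P.finalLaw G T' ≠ ⊤ :=
    ne_top_of_le_ne_top ENNReal.one_ne_top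
      ((ENNReal.tsum_comp_le_tsum_of_injective Subtype.val_injective _).trans
        (P.tsum_finalLaw_le_one G))
  rw [textLaw, ENNReal.div_pos_iff, if_pos hT, ← pos_iff_ne_zero, P.finalLaw_pos_iff]
  exact ⟨fun h => h.1.2, fun h => ⟨⟨hT.merge_eq_empty, h⟩, hfin⟩⟩

end Toric

theorem mainTheorem2 {D : Type*} (μ₁ μ₂ : ℝ) (hμ₁ : 0 < μ₁) (hμ₂ : 0 < μ₂)
    (P : Toric.ProductionProcess D) (L : Toric.LearningProcess D μ₁ μ₂)
    (S : (R : Toric.Grammar D) → Toric.ParsingProcess R)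
    (G R T : Toric.Grammar D) (hT : T.IsText) :
    -- the learning process
    (0 < L.finalLaw T G → 0 < Toric.ProductionProcess.textLaw P G T) ∧
    (0 < L.visitProb T G → 0 < Toric.ProductionProcess.textLaw P G T) ∧
    -- the parsing process with reference `R`
    (0 < (S R).finalLaw T G → 0 < Toric.ProductionProcess.textLaw P G T) ∧
    (0 < (S R).visitProb T G → 0 < Toric.ProductionProcess.textLaw P G T) ∧
    -- the parsing process with reference `G`
    (0 < Toric.ProductionProcess.textLaw P G T → 0 < (S G).visitProb T G) ∧
    (0 < Toric.ProductionProcess.textLaw P G T → G.narrowParse G = ∅ →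
      0 < (S G).finalLaw T G) ∧
    -- the local expressions of `G` lie in the support of `R`
    ((∀ e, G.weight e ≠ 0 → Toric.IsLocal e → R.weight e ≠ 0) →
      (0 < Toric.ProductionProcess.textLaw P G T ↔ 0 < (S R).visitProb T G) ∧
      (G.narrowParse R = ∅ →
        (0 < Toric.ProductionProcess.textLaw P G T ↔ 0 < (S R).finalLaw T G))) := by

  have hGR : ∀ R : Toric.Grammar D,
      (∀ e, G.weight e ≠ 0 → Toric.IsLocal e → R.weight e ≠ 0) → G.MergesTo T →
      Relation.ReflTransGen (fun G G' : Toric.Grammar D => G' ∈ G.narrowParse R) T G :=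
    fun R hR h => (hT.globalMergesTo h).reflTransGen_narrowParse hR
  have hRG : ∀ {R : Toric.Grammar D},
      Relation.ReflTransGen (fun G G' : Toric.Grammar D => G' ∈ G.narrowParse R) T G →
      G.MergesTo T := Toric.Grammar.mergesTo_of_reflTransGen_narrowParse
  simp only [P.textLaw_pos_iff hT, Toric.StoppedChain.finalLaw_pos_iff,
    Toric.StoppedChain.visitProb_pos_iff]
  exact ⟨fun h => hT.mergesTo_of_reflTransGen_learn h.2, hT.mergesTo_of_reflTransGen_learn,
    fun h => hRG h.2, hRG, hGR G fun _ h _ => h, fun h h0 => ⟨h0, hGR G (fun _ h _ => h) h⟩,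
    fun hR => ⟨⟨hGR R hR, hRG⟩, fun h0 => ⟨fun h => ⟨h0, hGR R hR h⟩, fun h => hRG h.2⟩⟩⟩
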